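/- An interaction system with $n$ nodes consists of action spaces $A_1,\dots,A_n$, with state space $A=A_1\times\dots\times A_n$, and reaction functions $f_i:A^+\to A_i$, where $A^+$ is the set of histories, i.e. nonempty finite sequences of states. The function $f_i$ is historyless if $f_i(H)$ depends only on the last state of $H$, and self-independent if $f_i(H)$ does not depend on the actions of node $i$ in the states of $H$. A schedule is a map $\sigma:\{1,2,3,\dots\}\to 2^{\{1,\dots,n\}}$. The $(H,\sigma)$-trajectory, for a history $H=(a^0,\dots,a^{\ell-1})$, is the infinite sequence $a^0,a^1,a^2,\dots$ extending $H$ such that, for all $t\ge\ell$ and all $i$, $a_i^t=f_i(a^0,\dots,a^{t-1})$ if $i\in\sigma(t)$ and $a_i^t=a_i^{t-1}$ otherwise. The trajectory converges if it is eventually constant. For an integer $r\ge 1$, a schedule is $r$-fair if $i\in\sigma(t)\cup\dots\cup\sigma(t+r-1)$ for every $t\ge1$ and every node $i$. The system is $r$-convergent if, for every history $H$ and every $r$-fair schedule $\sigma$, the $(H,\sigma)$-trajectory converges. **Theorem.** There are a constant $c>0$ and an integer $N$ such that for every $n\ge N$ there exist an integer $r\ge c\,2^n$ and an interaction system $G$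 with $n$ nodes, in which every node has exactly two possible actions and every reaction function is historyless and self-independent, such that $G$ is $r$-convergent but not $(r+1)$-convergent. -/

import Mathlib

/-- A history over a set `S`: a nonempty finite sequence `(a⁰, …, a^(len-1))` of elements of `S`. -/
structure History (S : Type) where
  len : ℕ
  len_pos : 0 < len
  seq : Fin len → S

namespace History

/-- The most recent entry `a^(len-1)` of a history. -/
def last {S : Type} (H : History S) : S :=
  H.seq ⟨H.len - 1, Nat.sub_lt H.len_pos Nat.one_pos⟩

/-- Apply a function to every entry of a history. -/
def map {S T : Type} (φ : S → T) (H : History S) : History T where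
  len := H.len
  len_pos := H.len_pos
  seq := fun s => φ (H.seq s)

end History

/-- An interaction system with `n` nodes: every node `i` has an action space `Act i` and a
deterministic reaction function from histories of states (elements of `∏ j, Act j`)
to its own actions. -/
structure InteractionSystem (n : ℕ) where
  Act : Fin n → Type
  react : (i : Fin n) → History ((j : Fin n) → Act j) → Act i

/-- A schedule tells which nodes are activated at each of the times `1, 2, 3, …`
(its value at `0` is never used). -/
abbrev Schedule (n : ℕ) : Type := ℕ → Set (Fin n)

/-- A schedule is `r`-fair if every node is activated at least once in every `r` consecutive
timesteps `t, …, t + r - 1`, `t ≥ 1`. -/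
def Schedule.IsRFair {n : ℕ} (σ : Schedule n) (r : ℕ) : Prop :=
  ∀ t : ℕ, 1 ≤ t → ∀ i : Fin n, ∃ s : ℕ, t ≤ s ∧ s < t + r ∧ i ∈ σ s

namespace InteractionSystem

variable {n : ℕ}

/-- The states of a system: one action for every node. -/
abbrev State (G : InteractionSystem n) : Type := (j : Fin n) → G.Act j

/-- The partial states `a_{-i}`: one action for every node other than `i`. -/
abbrev StateWithout (G : InteractionSystem n) (i : Fin n) : Type :=
  (j : {j : Fin n // j ≠ i}) → G.Act j.1

/-- The state `a` with the action of node `i` omitted. -/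
def omitNode (G : InteractionSystem n) (i : Fin n) (a : G.State) : G.StateWithout i :=
  fun j => a j.1

/-- The reaction function of node `i` is historyless: it depends only on the most recent state. -/
def IsHistoryless (G : InteractionSystem n) (i : Fin n) : Prop :=
  ∃ g : G.State → G.Act i, ∀ H : History G.State, G.react i H = g H.last

/-- The reaction function of node `i` is self-independent: it ignores the past and present
actions of node `i` itself. -/
def IsSelfIndependent (G : InteractionSystem n) (i : Fin n) : Prop :=
  ∃ g : History (G.StateWithout i) → G.Act i,
    ∀ H : History G.State, G.react i H = g (H.map (G.omitNode i))

open Classical in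
/-- The `(H, σ)`-trajectory: the infinite sequence of states that extends the history `H`, where
at each time `t ≥ H.len` the nodes in `σ t` apply their reaction functions to the history
`(a⁰, …, a^(t-1))` and all the other nodes keep their actions. -/
noncomputable def trajectory (G : InteractionSystem n) (H : History G.State) (σ : Schedule n)
    (t : ℕ) : G.State :=
  if h : t < H.len then H.seq ⟨t, h⟩
  else
    have hpos : 0 < t := lt_of_lt_of_le H.len_pos (not_lt.mp h)
    fun i =>
      if i ∈ σ t then G.react i ⟨t, hpos, fun s => trajectory G H σ s.1⟩
      else trajectory G H σ (t - 1) i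
termination_by t
decreasing_by
  · exact s.2
  · exact Nat.sub_lt hpos Nat.one_pos

/-- A sequence of states converges if it eventually remains at a single state. -/
def Converges (G : InteractionSystem n) (a : ℕ → G.State) : Prop :=
  ∃ b : G.State, ∃ T : ℕ, ∀ t : ℕ, T < t → a t = b

/-- A system is `r`-convergent if every trajectory that results from an `r`-fair schedule
(and any initial history) converges. -/
def IsRConvergent (G : InteractionSystem n) (r : ℕ) : Prop :=
  ∀ (H : History G.State) (σ : Schedule n), σ.IsRFair r → G.Converges (G.trajectory H σ)

end InteractionSystem

/-! Take a long induced cycle in a hypercube whose coordinates are nodes. Orient the cycle, and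
direct each other edge at one of its vertices towards that vertex. On the cycle exactly one node
then wants to move, so under any schedule the state waits or advances one step (`step_of_mem`).

Two extra nodes form a latch. One switches on when activated away from the base vertex, the other
copies it, and once both are on they stay on and force every cycle node off. Self-independence
prevents a node from remembering its own action, so the memory needs two nodes.

If twice the fairness is less than the length of the cycle, a trip round the cycle leaves time for
both latch nodes to act, so activity stops (`eventually_const`). If the fairness exceeds the length,
the latch can be activated only at the base, where it stays off, and the walk never ends
(`isRun_walkState`). Somewhere in between, convergence is lost from one `r` to the next
(`exists_isRConvergent_and_not_succ`).

The cycle must have length of order `2 ^ n`, so only boundedly many coordinates may be spent on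
making it induced. It follows the reflected Gray code on words, whose steps alternate between letter
`0` and `grayMate`. A step at letter `0` preserves the parity of the tail, and a step at `grayMate`
preserves an 8-valued colour; no other letter change does so. Ten indicator coordinates for colour
and parity therefore exclude chords (`grayState_induced`). -/

open Function

/-! ### Edges of the hypercube -/

/-- The vertex of the hypercube obtained from `v` by switching the coordinate `i`. -/
def flipAt {ι : Type} [DecidableEq ι] (v : ι → Bool) (i : ι) : ι → Bool :=
  update v i (!v i)

section FlipAt

variable {ι : Type} [DecidableEq ι]

@[simp]
theorem flipAt_same (v : ι → Bool) (i : ι) : flipAt v i i = !v i := by simp [flipAt]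

theorem flipAt_of_ne (v : ι → Bool) {i j : ι} (h : j ≠ i) : flipAt v i j = v j := by
  simp [flipAt, h]

@[simp]
theorem flipAt_flipAt (v : ι → Bool) (i : ι) : flipAt (flipAt v i) i = v := by
  simp [flipAt]

theorem flipAt_ne_self (v : ι → Bool) (i : ι) : flipAt v i ≠ v := fun h => by
  have := congrFun h i
  simp at this

end FlipAt

/-! ### Induced cycles and the reaction rule they define -/

/-- A directed induced cycle in the hypercube with coordinates `ι`: at a vertex `v` of the cycle
the coordinate `dir v` is switched next. The function `rank` shows that a walk along the cycle
that leaves `base` needs more than `span` steps to come back to it, and `height` shows that it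
does come back. -/
structure InducedCycle (ι : Type) [DecidableEq ι] where
  mem : (ι → Bool) → Prop
  dir : (ι → Bool) → ι
  base : ι → Bool
  rank : (ι → Bool) → ℕ
  height : (ι → Bool) → ℕ
  span : ℕ
  bound : ℕ
  mem_next : ∀ v, mem v → mem (flipAt v (dir v))
  induced : ∀ v i, mem v → mem (flipAt v i) → i = dir v ∨ i = dir (flipAt v i)
  dir_next_ne : ∀ v, mem v → dir (flipAt v (dir v)) ≠ dir v
  mem_base : mem base
  rank_base : rank base = 0
  span_le : ∀ v, mem v → flipAt v (dir v) = base → span ≤ rank v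
  rank_next : ∀ v, mem v → flipAt v (dir v) ≠ base → rank (flipAt v (dir v)) ≤ rank v + 1
  height_next : ∀ v, mem v →
    flipAt v (dir v) = base ∨ height v < height (flipAt v (dir v))
  height_lt : ∀ v, mem v → height v < bound

namespace InducedCycle

variable {ι : Type} [DecidableEq ι] (K : InducedCycle ι)

open Classical in
/-- The orientation of the hypercube in which the cycle is directed and all other edges at a vertex
of the cycle point towards the cycle. -/
noncomputable def orient (i : ι) (v : ι → Bool) : Bool :=
  decide (K.mem (update v i true) ∧ (K.mem (update v i false) → K.dir (update v i false) = i))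

theorem orient_update (i : ι) (v : ι → Bool) (b : Bool) :
    K.orient i (update v i b) = K.orient i v := by
  simp [orient]

/-- Both ends of this edge lie on the cycle; `dir_next_ne` rules out that each end points to the
other, so the orientation is consistent. -/
theorem orient_dir {v : ι → Bool} (hv : K.mem v) : K.orient (K.dir v) v = !v (K.dir v) := by
  have h1 := K.mem_next v hv
  have h2 := K.dir_next_ne v hv
  have h3 : update v (K.dir v) (v (K.dir v)) = v := update_eq_self _ _
  unfold flipAt at h1 h2
  cases h : v (K.dir v) <;> simp only [h, Bool.not_false, Bool.not_true] at h1 h2 h3 ⊢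
  · simp [orient, h1, h3]
  · simp [orient, h1, h2]

/-- By inducedness the edge either leaves the cycle, and then points to `v`, or is the cycle edge
entering `v`. -/
theorem orient_of_ne {v : ι → Bool} (hv : K.mem v) {i : ι} (hi : i ≠ K.dir v) :
    K.orient i v = v i := by
  have h1 := K.induced v i hv
  have h3 : update v i (v i) = v := update_eq_self _ _
  unfold flipAt at h1
  cases h : v i <;> simp only [h, Bool.not_false, Bool.not_true] at h1 h3 ⊢
  · simp [orient, h3, hv, hi.symm]
  · simp only [orient, h3, hv, true_and, decide_eq_true_eq]
    intro h4
    exact ((h1 h4).resolve_left hi).symm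

open Classical in
/-- The reaction functions on the nodes of the cycle and two more nodes, `some none` and `none`,
which together stop all activity for good once both of them are switched on. -/
noncomputable def reaction (i : Option (Option ι)) (a : Option (Option ι) → Bool) : Bool :=
  match i with
  | none => a (some none)
  | some none => a none || !decide ((fun j => a (some (some j))) = K.base)
  | some (some i) => !(a none && a (some none)) && K.orient i (fun j => a (some (some j)))

theorem reaction_update (i : Option (Option ι)) (a : Option (Option ι) → Bool) (b : Bool) :
    K.reaction i (update a i b) = K.reaction i a := by
  rcases i with _ | _ | i
  · simp [reaction]
  · have h : (fun j => update a (some none) b (some (some j))) = fun j => a (some (some j)) := by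
      funext j
      simp
    rw [Bool.eq_iff_iff]
    simp only [reaction, Bool.or_eq_true, Bool.not_eq_true', decide_eq_false_iff_not, h]
    simp
  · have h : (fun j => update a (some (some i)) b (some (some j))) =
        update (fun j => a (some (some j))) i b := by
      ext j
      by_cases hj : j = i
      · subst hj; simp
      · simp [hj]
    simp [reaction, h, orient_update]

end InducedCycle

/-! ### Convergence when fairness is short compared with the cycle -/

/-- `a` is a run of the synchronous-update rule `f` in which at the step from `t` to `t + 1` the
nodes in `τ t` are activated. -/
def IsRun {κ : Type} (f : κ → (κ → Bool) → Bool) (τ : ℕ → Set κ) (a : ℕ → κ → Bool) : Prop :=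
  ∀ t i, (i ∈ τ t → a (t + 1) i = f i (a t)) ∧ (i ∉ τ t → a (t + 1) i = a t i)

namespace InducedCycle

variable {ι : Type} [DecidableEq ι] (K : InducedCycle ι)

section Convergence

variable {τ : ℕ → Set (Option (Option ι))} {a : ℕ → Option (Option ι) → Bool}

theorem stopped_of_le (ha : IsRun K.reaction τ a) {t : ℕ} (h0 : a t none = true)
    (h1 : a t (some none) = true) (s : ℕ) (hs : t ≤ s) :
    a s none = true ∧ a s (some none) = true := by
  induction s, hs using Nat.le_induction with
  | base => exact ⟨h0, h1⟩
  | succ s _ ih =>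
    constructor
    · by_cases h : none ∈ τ s
      · rw [(ha s none).1 h]; exact ih.2
      · rw [(ha s none).2 h]; exact ih.1
    · by_cases h : some none ∈ τ s
      · rw [(ha s (some none)).1 h]; simp [reaction, ih.1]
      · rw [(ha s (some none)).2 h]; exact ih.2

theorem eventually_const_of_stopped (ha : IsRun K.reaction τ a) {r : ℕ}
    (hτ : ∀ t i, ∃ s, t ≤ s ∧ s < t + r ∧ i ∈ τ s) {t : ℕ} (h0 : a t none = true)
    (h1 : a t (some none) = true) : ∃ b, ∃ T, ∀ s, T < s → a s = b := by
  have hd := K.stopped_of_le ha h0 h1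
  refine ⟨fun i => i.elim true (fun j => j.elim true (fun _ => false)), t + r, fun s hs => ?_⟩
  funext i
  rcases i with _ | _ | i
  · exact (hd s (by omega)).1
  · exact (hd s (by omega)).2
  · obtain ⟨u, hu1, hu2, hu⟩ := hτ t (some (some i))
    have key : ∀ w, u + 1 ≤ w → a w (some (some i)) = false := by
      intro w hw
      induction w, hw using Nat.le_induction with
      | base => rw [(ha u _).1 hu]; simp [reaction, (hd u hu1).1, (hd u hu1).2]
      | succ w hw ih =>
        by_cases h : some (some i) ∈ τ w
        · rw [(ha w _).1 h]; simp [reaction, (hd w (by omega)).1, (hd w (by omega)).2]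
        · rw [(ha w _).2 h]; exact ih
    exact key s (by omega)

/-- The first `r` steps switch on `some none`, which stays on while the base is avoided; the next
`r` steps let `none` copy it. -/
theorem stopped_of_ne_base (ha : IsRun K.reaction τ a) {r : ℕ}
    (hτ : ∀ t i, ∃ s, t ≤ s ∧ s < t + r ∧ i ∈ τ s) (t : ℕ)
    (hne : ∀ s, t ≤ s → s ≤ t + 2 * r → (fun j => a s (some (some j))) ≠ K.base) :
    a (t + 2 * r) none = true ∧ a (t + 2 * r) (some none) = true := by
  obtain ⟨u, hu1, hu2, hu⟩ := hτ t (some none)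
  obtain ⟨w, hw1, hw2, hw⟩ := hτ (t + r) none
  have hz : ∀ s, u + 1 ≤ s → s ≤ t + 2 * r → a s (some none) = true := by
    intro s hs
    induction s, hs using Nat.le_induction with
    | base => intro _; rw [(ha u _).1 hu]; simp [reaction, hne u hu1 (by omega)]
    | succ s hs ih =>
      intro h
      by_cases hm : some none ∈ τ s
      · rw [(ha s _).1 hm]; simp [reaction, hne s (by omega) (by omega)]
      · rw [(ha s _).2 hm]; exact ih (by omega)
  have hy : ∀ s, w + 1 ≤ s → s ≤ t + 2 * r → a s none = true := by
    intro s hs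
    induction s, hs using Nat.le_induction with
    | base => intro _; rw [(ha w _).1 hw]; exact hz w (by omega) (by omega)
    | succ s hs ih =>
      intro h
      by_cases hm : none ∈ τ s
      · rw [(ha s _).1 hm]; exact hz s (by omega) (by omega)
      · rw [(ha s _).2 hm]; exact ih (by omega)
  exact ⟨hy _ (by omega) le_rfl, hz _ (by omega) le_rfl⟩

theorem step_of_mem (ha : IsRun K.reaction τ a) {t : ℕ}
    (hd : ¬ (a t none = true ∧ a t (some none) = true)) {v : ι → Bool}
    (hv : (fun j => a t (some (some j))) = v) (hm : K.mem v) :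
    (fun j => a (t + 1) (some (some j))) =
      open Classical in if some (some (K.dir v)) ∈ τ t then flipAt v (K.dir v) else v := by
  have hd' : (a t none && a t (some none)) = false := by
    simpa only [← Bool.and_eq_true, Bool.not_eq_true] using hd
  have hvj : ∀ j, a t (some (some j)) = v j := fun j => congrFun hv j
  funext j
  by_cases hj : j = K.dir v
  · subst hj
    split_ifs with h
    · rw [(ha t _).1 h]; simp [reaction, hd', hv, K.orient_dir hm]
    · rw [(ha t _).2 h, hvj]
  · have h1 : a (t + 1) (some (some j)) = v j := by
      by_cases h : some (some j) ∈ τ t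
      · rw [(ha t _).1 h]; simp [reaction, hd', hv, K.orient_of_ne hm hj]
      · rw [(ha t _).2 h, hvj]
    split_ifs
    · rw [h1, flipAt_of_ne _ hj]
    · exact h1

/-- A run that never stops must visit the base and, by fairness, leave it. It then follows the
cycle, at most one step per unit of time, and is away long enough for the latch to close. -/
theorem eventually_const (ha : IsRun K.reaction τ a) {r : ℕ} (hr : 2 * r + 1 ≤ K.span)
    (hτ : ∀ t i, ∃ s, t ≤ s ∧ s < t + r ∧ i ∈ τ s) : ∃ b, ∃ T, ∀ s, T < s → a s = b := by
  by_cases hdead : ∃ t, a t none = true ∧ a t (some none) = true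
  · obtain ⟨t, h0, h1⟩ := hdead
    exact K.eventually_const_of_stopped ha hτ h0 h1
  exfalso
  push Not at hdead
  have hd : ∀ t, ¬ (a t none = true ∧ a t (some none) = true) := fun t h => hdead t h.1 h.2
  obtain ⟨t₀, ht₀⟩ : ∃ t, (fun j => a t (some (some j))) = K.base := by
    by_contra! h
    exact hd _ (K.stopped_of_ne_base ha hτ 0 (fun s _ _ => h s))
  obtain ⟨t₁, ht₁, ht₁'⟩ : ∃ t, (fun j => a t (some (some j))) = K.base ∧
      (fun j => a (t + 1) (some (some j))) ≠ K.base := by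
    by_contra! h
    have hall : ∀ s, t₀ ≤ s → (fun j => a s (some (some j))) = K.base := by
      intro s hs
      induction s, hs using Nat.le_induction with
      | base => exact ht₀
      | succ s _ ih => exact h s ih
    obtain ⟨s, hs, -, hmem⟩ := hτ t₀ (some (some (K.dir K.base)))
    have := K.step_of_mem ha (hd s) (hall s hs) K.mem_base
    rw [if_pos hmem, hall (s + 1) (by omega)] at this
    exact flipAt_ne_self _ _ this.symm
  -- `rank` grows by at most one per step and must reach `span` before the base can recur. The times
  -- `j ≤ 2 * r` needed below satisfy `j + 1 ≤ span`.
  have key : ∀ j, j + 1 ≤ K.span → K.mem (fun i => a (t₁ + 1 + j) (some (some i))) ∧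
      (fun i => a (t₁ + 1 + j) (some (some i))) ≠ K.base ∧
      K.rank (fun i => a (t₁ + 1 + j) (some (some i))) ≤ j + 1 := by
    intro j
    induction j with
    | zero =>
      intro _
      have h := K.step_of_mem ha (hd t₁) ht₁ K.mem_base
      refine ⟨?_, ht₁', ?_⟩
      · simp only [add_zero, h]
        split_ifs
        · exact K.mem_next _ K.mem_base
        · exact K.mem_base
      · have hne := ht₁'
        rw [h] at hne
        simp only [add_zero, h]
        split_ifs with hc
        · rw [if_pos hc] at hne
          have := K.rank_next _ K.mem_base hne
          rwa [K.rank_base] at this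
        · simp [K.rank_base]
    | succ j ih =>
      intro hj
      obtain ⟨hm, hne, hrk⟩ := ih (by omega)
      have h := K.step_of_mem ha (hd (t₁ + 1 + j)) rfl hm
      rw [← add_assoc, h]
      split_ifs
      · have hb : flipAt _ (K.dir _) ≠ K.base := fun hb => by
          have := K.span_le _ hm hb
          omega
        have := K.rank_next _ hm hb
        exact ⟨K.mem_next _ hm, hb, by omega⟩
      · exact ⟨hm, hne, by omega⟩
  refine hd _ (K.stopped_of_ne_base ha hτ (t₁ + 1) (fun s hs1 hs2 => ?_))
  obtain ⟨j, rfl⟩ := Nat.exists_eq_add_of_le hs1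
  exact (key j (by omega)).2.1

end Convergence

/-! ### An endless walk when fairness exceeds the cycle -/

section Divergence

/-- The walk along the cycle that starts at its base. -/
def walk : ℕ → ι → Bool
  | 0 => K.base
  | t + 1 => flipAt (walk t) (K.dir (walk t))

theorem mem_walk (t : ℕ) : K.mem (K.walk t) := by
  induction t with
  | zero => exact K.mem_base
  | succ t ih => exact K.mem_next _ ih

/-- Away from the base `height` increases strictly, and it is bounded. -/
theorem exists_walk_eq_base (t : ℕ) : ∃ s, t ≤ s ∧ s < t + (K.bound + 1) ∧ K.walk s = K.base := by
  by_contra! h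
  have key : ∀ j, j ≤ K.bound → j ≤ K.height (K.walk (t + j)) := by
    intro j
    induction j with
    | zero => intro _; exact Nat.zero_le _
    | succ j ih =>
      intro hj
      have h1 := ih (by omega)
      have h2 := (K.height_next _ (K.mem_walk (t + j))).resolve_left
        (h (t + j + 1) (by omega) (by omega))
      rw [← add_assoc, walk]
      omega
  have h1 := key K.bound le_rfl
  have h2 := K.height_lt _ (K.mem_walk (t + K.bound))
  omega

/-- The states of the system that accompany the walk along the cycle, with the two additional nodes
switched off. -/
def walkState (t : ℕ) (i : Option (Option ι)) : Bool :=
  i.elim false fun j => j.elim false (K.walk t)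

/-- The schedule that activates the two additional nodes only at the base of the cycle. -/
def walkSchedule (t : ℕ) : Set (Option (Option ι)) :=
  {i | (∃ j, i = some (some j)) ∨ K.walk t = K.base}

theorem isRun_walkState : IsRun K.reaction K.walkSchedule K.walkState := by
  intro t i
  rcases i with _ | _ | i
  · simp [walkState, reaction]
  · simp only [walkState, reaction, walkSchedule, Option.elim]
    simp only [Set.mem_ofPred_eq, Option.some.injEq, reduceCtorEq, exists_false, false_or,
      Bool.false_or, implies_true, and_true]
    intro h
    simp only [Bool.false_eq, Bool.not_eq_false']
    exact @decide_eq_true _ (_) h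
  · refine ⟨fun _ => ?_, fun h => absurd (Or.inl ⟨i, rfl⟩) h⟩
    have : K.reaction (some (some i)) (K.walkState t) = K.orient i (K.walk t) := by
      simp [reaction, walkState]
    rw [this]
    simp only [walkState, Option.elim, walk]
    by_cases hi : i = K.dir (K.walk t)
    · subst hi
      rw [K.orient_dir (K.mem_walk t), flipAt_same]
    · rw [K.orient_of_ne (K.mem_walk t) hi, flipAt_of_ne _ hi]

theorem walkSchedule_fair (t : ℕ) (i : Option (Option ι)) :
    ∃ s, t ≤ s ∧ s < t + (K.bound + 1) ∧ i ∈ K.walkSchedule s := by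
  obtain ⟨s, h1, h2, h3⟩ := K.exists_walk_eq_base t
  exact ⟨s, h1, h2, Or.inr h3⟩

theorem walkState_succ_ne (t : ℕ) : K.walkState (t + 1) ≠ K.walkState t := by
  intro h
  have h1 := congrFun h (some (some (K.dir (K.walk t))))
  simp [walkState, walk] at h1

end Divergence

end InducedCycle

/-! ### From Boolean rules to interaction systems -/

namespace InteractionSystem

variable {n : ℕ} {κ : Type}

/-- The historyless system with binary actions whose nodes are labelled by `κ` and react
according to `f`. -/
abbrev ofRule (e : Fin n ≃ κ) (f : κ → (κ → Bool) → Bool) : InteractionSystem n where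
  Act := fun _ => Bool
  react := fun i H => f (e i) (fun k => H.last (e.symm k))

variable (e : Fin n ≃ κ) (f : κ → (κ → Bool) → Bool)

theorem ofRule_isHistoryless (i : Fin n) : (ofRule e f).IsHistoryless i :=
  ⟨fun a => f (e i) (fun k => a (e.symm k)), fun _ => rfl⟩

theorem ofRule_isSelfIndependent [DecidableEq κ]
    (hf : ∀ k a b, f k (update a k b) = f k a) (i : Fin n) :
    (ofRule e f).IsSelfIndependent i := by
  classical
  -- The missing action of node `i` is filled in with `false`; by `hf` its value is irrelevant.
  refine ⟨fun H => f (e i) (fun k => if h : e.symm k ≠ i then H.last ⟨e.symm k, h⟩ else false),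
    fun H => ?_⟩
  change f (e i) _ = f (e i) _
  rw [← hf (e i) (fun k => H.last (e.symm k)) false]
  congr 1
  funext k
  by_cases hk : k = e i
  · subst hk; simp
  · have : e.symm k ≠ i := fun h => hk (by rw [← h, e.apply_symm_apply])
    simp [hk, this, History.last, History.map, omitNode]

theorem trajectory_of_lt (G : InteractionSystem n) (H : History G.State) (σ : Schedule n) {t : ℕ}
    (h : t < H.len) : G.trajectory H σ t = H.seq ⟨t, h⟩ := by
  rw [trajectory, dif_pos h]

theorem ofRule_trajectory_succ (H : History (ofRule e f).State) (σ : Schedule n) {t : ℕ}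
    (h : H.len ≤ t + 1) (i : Fin n) :
    (i ∈ σ (t + 1) → (ofRule e f).trajectory H σ (t + 1) i =
      f (e i) (fun k => (ofRule e f).trajectory H σ t (e.symm k))) ∧
    (i ∉ σ (t + 1) → (ofRule e f).trajectory H σ (t + 1) i = (ofRule e f).trajectory H σ t i) := by
  constructor
  · intro hi
    rw [trajectory, dif_neg (by omega)]
    simp only [hi, if_true]
    rfl
  · intro hi
    rw [trajectory, dif_neg (by omega)]
    simp only [hi, if_false]
    rfl

theorem ofRule_isRConvergent {r : ℕ}
    (h : ∀ (τ : ℕ → Set κ) (a : ℕ → κ → Bool), IsRun f τ a →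
      (∀ t i, ∃ s, t ≤ s ∧ s < t + r ∧ i ∈ τ s) → ∃ b, ∃ T, ∀ s, T < s → a s = b) :
    (ofRule e f).IsRConvergent r := by
  intro H σ hσ
  have hl := H.len_pos
  -- Since the rule is historyless, the trajectory is a run from the last state of `H` on; the step
  -- from `t` to `t + 1` uses the schedule at the later time.
  obtain ⟨b, T, hb⟩ := h (fun t => {k | e.symm k ∈ σ (H.len - 1 + t + 1)})
    (fun t k => (ofRule e f).trajectory H σ (H.len - 1 + t) (e.symm k))
    (fun t k => by
      have := ofRule_trajectory_succ e f H σ (t := H.len - 1 + t) (by omega) (e.symm k)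
      rwa [e.apply_symm_apply] at this)
    (fun t k => by
      obtain ⟨s, h1, h2, h3⟩ := hσ (H.len - 1 + t + 1) (by omega) (e.symm k)
      refine ⟨s - H.len, by omega, by omega, ?_⟩
      have : H.len - 1 + (s - H.len) + 1 = s := by omega
      simpa [this] using h3)
  refine ⟨fun i => b (e i), H.len - 1 + T, fun t ht => ?_⟩
  have := hb (t - (H.len - 1)) (by omega)
  rw [Nat.add_sub_cancel' (by omega)] at this
  funext i
  obtain ⟨k, rfl⟩ := e.symm.surjective i
  simpa using congrFun this k

theorem not_ofRule_isRConvergent {r : ℕ} {τ : ℕ → Set κ} {a : ℕ → κ → Bool} (ha : IsRun f τ a)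
    (hτ : ∀ t i, ∃ s, t ≤ s ∧ s < t + r ∧ i ∈ τ s) (hne : ∀ t, a (t + 1) ≠ a t) :
    ¬ (ofRule e f).IsRConvergent r := by
  intro hconv
  let H : History (ofRule e f).State := ⟨1, Nat.one_pos, fun _ i => a 0 (e i)⟩
  let σ : Schedule n := fun t => {i | e i ∈ τ (t - 1)}
  have hfair : σ.IsRFair r := by
    intro t ht i
    obtain ⟨s, h1, h2, h3⟩ := hτ (t - 1) (e i)
    exact ⟨s + 1, by omega, by omega, by simpa [σ] using h3⟩
  have htraj : ∀ t, (ofRule e f).trajectory H σ t = fun i => a t (e i) := by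
    intro t
    induction t with
    | zero => exact trajectory_of_lt _ H σ Nat.one_pos
    | succ t ih =>
      funext i
      have h := ofRule_trajectory_succ e f H σ (t := t) (by simp [H]) i
      rw [ih] at h
      simp only [e.apply_symm_apply] at h
      by_cases hi : e i ∈ τ t
      · rw [h.1 hi, (ha t _).1 hi]
      · rw [h.2 hi, (ha t _).2 hi]
  obtain ⟨b, T, hb⟩ := hconv H σ hfair
  refine hne (T + 1) (funext fun k => ?_)
  have := (hb (T + 2) (by omega)).trans (hb (T + 1) (by omega)).symm
  rw [htraj, htraj] at this
  simpa using congrFun this (e.symm k)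

/-- Otherwise convergence propagates upwards from `r` by induction. If `R ≤ r`, it passes down to
`R` because `R`-fair schedules are `r`-fair. -/
theorem exists_isRConvergent_and_not_succ (G : InteractionSystem n) {r R : ℕ}
    (hr : G.IsRConvergent r) (hR : ¬ G.IsRConvergent R) :
    ∃ s, r ≤ s ∧ G.IsRConvergent s ∧ ¬ G.IsRConvergent (s + 1) := by
  by_contra! h
  have hall : ∀ s, r ≤ s → G.IsRConvergent s := by
    intro s hs
    induction s, hs using Nat.le_induction with
    | base => exact hr
    | succ s hs ih => exact h s hs ih
  rcases le_total r R with h1 | h1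
  · exact hR (hall R h1)
  · refine hR fun H σ hσ => hr H σ fun t ht i => ?_
    obtain ⟨s, h2, h3, h4⟩ := hσ t ht i
    exact ⟨s, h2, by omega, h4⟩

end InteractionSystem

/-! ### The reflected Gray code and its colouring -/

section GrayCode

/-- The parity of the number of ones in a word. -/
def wordParity : {m : ℕ} → (Fin m → Bool) → Bool
  | 0, _ => false
  | _ + 1, x => xor (x 0) (wordParity (Fin.tail x))

/-- The position of a word in the reflected Gray code, the letter `0` being the one that is
switched most often. -/
def grayRank : {m : ℕ} → (Fin m → Bool) → ℕ
  | 0, _ => 0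
  | _ + 1, x => 2 * grayRank (Fin.tail x) + (wordParity x).toNat

/-- The letter that the Gray code switches after an odd word or before an even word. -/
def grayMate : {m : ℕ} → (Fin (m + 1) → Bool) → Fin (m + 1)
  | 0, _ => 0
  | _ + 1, x => if x 0 then 1 else (grayMate (Fin.tail x)).succ

/-- An element of `Fin 4` other than `a`, `b` and `3`. -/
def avoid (a b : Fin 4) : Fin 4 :=
  if a ≠ 0 ∧ b ≠ 0 then 0 else if a ≠ 1 ∧ b ≠ 1 then 1 else 2

theorem avoid_ne (a b : Fin 4) : avoid a b ≠ a ∧ avoid a b ≠ b := by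
  revert a b; decide

/-- The colours of the words `0y` and `1y`. -/
def colorPair : {m : ℕ} → (Fin m → Bool) → (Bool × Fin 4) × (Bool × Fin 4)
  | 0, _ => ((false, 3), (false, 3))
  | _ + 1, y =>
    (cond (y 0) (colorPair (Fin.tail y)).2 (colorPair (Fin.tail y)).1,
      (wordParity (Fin.tail y),
        avoid (colorPair (Fin.tail y)).1.2 (colorPair (Fin.tail y)).2.2))

/-- A colouring of the words such that neighbours `x` and `y` in the hypercube have the same colour
if and only if they differ at the letter `grayMate x`. -/
def color {m : ℕ} (x : Fin (m + 1) → Bool) : Bool × Fin 4 :=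
  cond (x 0) (colorPair (Fin.tail x)).2 (colorPair (Fin.tail x)).1

theorem tail_flipAt_zero {m : ℕ} (x : Fin (m + 1) → Bool) :
    Fin.tail (flipAt x 0) = Fin.tail x := by
  funext i
  exact flipAt_of_ne _ (Fin.succ_ne_zero i)

theorem tail_flipAt_succ {m : ℕ} (x : Fin (m + 1) → Bool) (i : Fin m) :
    Fin.tail (flipAt x i.succ) = flipAt (Fin.tail x) i := by
  funext j
  by_cases h : j = i
  · subst h; simp [Fin.tail]
  · rw [flipAt_of_ne _ h]
    exact flipAt_of_ne _ (by simpa using h)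

theorem flipAt_succ_zero {m : ℕ} (x : Fin (m + 1) → Bool) (i : Fin m) :
    flipAt x i.succ 0 = x 0 :=
  flipAt_of_ne _ (Fin.succ_ne_zero i).symm

theorem wordParity_flipAt {m : ℕ} (x : Fin m → Bool) (i : Fin m) :
    wordParity (flipAt x i) = !wordParity x := by
  induction m with
  | zero => exact i.elim0
  | succ m ih =>
    cases i using Fin.cases with
    | zero => simp [wordParity, tail_flipAt_zero]
    | succ i => simp [wordParity, tail_flipAt_succ, flipAt_succ_zero, ih]

theorem color_succ_of_false {m : ℕ} {x : Fin (m + 2) → Bool} (h : x 0 = false) :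
    color x = color (Fin.tail x) := by
  simp [color, h, colorPair]

theorem color_succ_of_true {m : ℕ} {x : Fin (m + 2) → Bool} (h : x 0 = true) :
    color x = (wordParity (Fin.tail (Fin.tail x)),
      avoid (colorPair (Fin.tail (Fin.tail x))).1.2 (colorPair (Fin.tail (Fin.tail x))).2.2) := by
  simp [color, h, colorPair]

/-- The colour of `1y` avoids, in its second component, the colours of both words that share the
tail of `y`; the colour of `0y` is one of these. -/
theorem color_flipAt_zero_ne {m : ℕ} {x : Fin (m + 2) → Bool} (h : x 0 = false) :
    color (flipAt x 0) ≠ color x := by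
  rw [color_succ_of_false h, color_succ_of_true (by simp [h]), tail_flipAt_zero, color]
  intro h1
  have h2 := congrArg Prod.snd h1
  have h3 := avoid_ne (colorPair (Fin.tail (Fin.tail x))).1.2
    (colorPair (Fin.tail (Fin.tail x))).2.2
  cases hc : Fin.tail x 0 <;> simp only [hc, cond_true, cond_false] at h2
  · exact h3.1 h2
  · exact h3.2 h2

/-- For words starting with `0` this is inherited from the tail. For those starting with `1` the
mate is letter `1`, and switching a later letter changes the parity in the first component. -/
theorem eq_grayMate_of_color_eq {m : ℕ} (x : Fin (m + 1) → Bool) (i : Fin (m + 1))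
    (h : color (flipAt x i) = color x) : i = grayMate x := by
  induction m with
  | zero => omega
  | succ m ih =>
    cases i using Fin.cases with
    | zero =>
      exfalso
      cases h0 : x 0
      · exact color_flipAt_zero_ne h0 h
      · refine color_flipAt_zero_ne (x := flipAt x 0) (by simp [h0]) ?_
        rw [flipAt_flipAt, h]
    | succ i =>
      cases h0 : x 0
      · rw [color_succ_of_false (by rw [flipAt_succ_zero, h0]), color_succ_of_false h0,
          tail_flipAt_succ] at h
        simp [grayMate, h0, ← ih _ _ h]
      · cases i using Fin.cases with
        | zero => simp [grayMate, h0]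
        | succ i =>
          rw [color_succ_of_true (by rw [flipAt_succ_zero, h0]), color_succ_of_true h0,
            tail_flipAt_succ, tail_flipAt_succ, wordParity_flipAt] at h
          simpa using congrArg Prod.fst h

theorem color_flipAt_grayMate {m : ℕ} (x : Fin (m + 1) → Bool) :
    color (flipAt x (grayMate x)) = color x := by
  induction m with
  | zero => simp [color, colorPair]
  | succ m ih =>
    cases h0 : x 0
    · have : grayMate x = (grayMate (Fin.tail x)).succ := by simp [grayMate, h0]
      rw [this, color_succ_of_false (by rw [flipAt_succ_zero, h0]), color_succ_of_false h0,
        tail_flipAt_succ, ih]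
    · have : grayMate x = (0 : Fin (m + 1)).succ := by simp [grayMate, h0]
      rw [this, color_succ_of_true (by rw [flipAt_succ_zero, h0]), color_succ_of_true h0,
        tail_flipAt_succ, tail_flipAt_zero]

theorem grayMate_flipAt_grayMate {m : ℕ} (x : Fin (m + 1) → Bool) :
    grayMate (flipAt x (grayMate x)) = grayMate x := by
  refine (eq_grayMate_of_color_eq _ _ ?_).symm
  rw [flipAt_flipAt, color_flipAt_grayMate]

theorem grayRank_lt {m : ℕ} (x : Fin m → Bool) : grayRank x < 2 ^ m := by
  induction m with
  | zero => simp [grayRank]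
  | succ m ih =>
    have h1 := ih (Fin.tail x)
    have h2 := Bool.toNat_le (wordParity x)
    rw [grayRank, pow_succ]
    omega

theorem wordParity_zero {m : ℕ} : wordParity (fun _ : Fin m => false) = false := by
  induction m with
  | zero => rfl
  | succ m ih => exact (Bool.false_xor _).trans ih

theorem grayRank_zero {m : ℕ} : grayRank (fun _ : Fin m => false) = 0 := by
  induction m with
  | zero => rfl
  | succ m ih => 
    rw [grayRank, wordParity_zero]
    exact (congrArg (2 * · + 0) ih).trans rfl

theorem grayRank_flipAt_zero {m : ℕ} {x : Fin (m + 1) → Bool} (h : wordParity x = false) :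
    grayRank (flipAt x 0) = grayRank x + 1 := by
  simp [grayRank, wordParity_flipAt, h, tail_flipAt_zero]

/-- After a leading `1` the tail is even and moves at its own letter `0`; after a leading `0` the
tail is odd and the claim recurs. The second alternative is the wrap-around from the last word to
the first. -/
theorem grayRank_flipAt_grayMate {m : ℕ} {x : Fin (m + 1) → Bool} (h : wordParity x = true) :
    (flipAt x (grayMate x) ≠ (fun _ => false) ∧
      grayRank (flipAt x (grayMate x)) = grayRank x + 1) ∨
    (flipAt x (grayMate x) = (fun _ => false) ∧ grayRank x + 1 = 2 ^ (m + 1)) := by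
  induction m with
  | zero =>
    right
    have h0 : x 0 = true := by simpa [wordParity] using h
    constructor
    · funext i
      obtain rfl : i = 0 := by omega
      simp [grayMate, h0]
    · simp [grayRank, h]
  | succ m ih =>
    cases h0 : x 0
    · have hm : grayMate x = (grayMate (Fin.tail x)).succ := by simp [grayMate, h0]
      have hp : wordParity (Fin.tail x) = true := by simpa [wordParity, h0] using h
      have hr : grayRank (flipAt x (grayMate x)) =
          2 * grayRank (flipAt (Fin.tail x) (grayMate (Fin.tail x))) := by
        rw [grayRank, wordParity_flipAt, h, hm, tail_flipAt_succ]; simp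
      have hx : grayRank x = 2 * grayRank (Fin.tail x) + 1 := by rw [grayRank, h]; rfl
      rcases ih hp with ⟨h1, h2⟩ | ⟨h1, h2⟩
      · refine Or.inl ⟨fun hc => h1 ?_, by omega⟩
        rw [← tail_flipAt_succ, ← hm, hc]
        rfl
      · refine Or.inr ⟨?_, by rw [pow_succ]; omega⟩
        funext i
        cases i using Fin.cases with
        | zero => rw [hm, flipAt_succ_zero, h0]
        | succ i =>
          rw [← tail_flipAt_succ, ← hm] at h1
          exact congrFun h1 i
    · have hm : grayMate x = (0 : Fin (m + 1)).succ := by simp [grayMate, h0]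
      have hp : wordParity (Fin.tail x) = false := by simpa [wordParity, h0] using h
      left
      constructor
      · intro hc
        have := congrFun hc 0
        rw [hm, flipAt_succ_zero, h0] at this
        exact absurd this (by simp)
      · rw [grayRank, wordParity_flipAt, h, hm, tail_flipAt_succ, grayRank_flipAt_zero hp,
          grayRank.eq_2 _ x, h]
        simp
        omega

end GrayCode

/-! ### The Gray code as an induced cycle -/

section GrayCycle

variable {m : ℕ}

/-- The coordinates of the hypercube in which the Gray code becomes an induced cycle: the letters of
the word, the colours, and the two parities. -/
abbrev GrayIndex (m : ℕ) : Type := Fin (m + 1) ⊕ ((Bool × Fin 4) ⊕ Bool)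

/-- The vertex with the word `x` at which the coordinate of the colour of `x` has the value `α`, that
of the parity of the tail of `x` has the value `β`, and the other ones are off. -/
def grayState (x : Fin (m + 1) → Bool) (α β : Bool) : GrayIndex m → Bool :=
  Sum.elim x (Sum.elim (fun k => α && decide (k = color x))
    (fun k => β && decide (k = wordParity (Fin.tail x))))

/-- Whether `grayState x α β` lies on the cycle. -/
def grayOk (x : Fin (m + 1) → Bool) (α β : Bool) : Bool :=
  cond (wordParity x) (!(α && β)) (α || β)

/-- The coordinate that the cycle switches at `grayState x α β`. -/
def grayDir (x : Fin (m + 1) → Bool) (α β : Bool) : GrayIndex m :=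
  match wordParity x, α, β with
  | false, true, true => .inr (.inl (color x))
  | false, true, false => .inr (.inr (wordParity (Fin.tail x)))
  | false, false, _ => .inl 0
  | true, true, _ => .inl (grayMate x)
  | true, false, true => .inr (.inr (wordParity (Fin.tail x)))
  | true, false, false => .inr (.inl (color x))

/-- The number of steps that the cycle has spent at the present word. -/
def grayStage (p α β : Bool) : ℕ :=
  match p, α, β with
  | false, true, false => 0
  | false, true, true => 1
  | false, false, _ => 2
  | true, _, true => 0
  | true, false, false => 1
  | true, true, false => 2

theorem grayStage_le (p α β : Bool) : grayStage p α β ≤ 2 := by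
  revert p α β; decide

/-- The value at a vertex `v` of a function of words and two further bits. -/
def grayRead {T : Type} (F : (Fin (m + 1) → Bool) → Bool → Bool → T) (v : GrayIndex m → Bool) : T :=
  F (fun i => v (.inl i)) (v (.inr (.inl (color fun i => v (.inl i)))))
    (v (.inr (.inr (wordParity (Fin.tail fun i => v (.inl i))))))

@[simp]
theorem grayRead_grayState {T : Type} (F : (Fin (m + 1) → Bool) → Bool → Bool → T)
    (x : Fin (m + 1) → Bool) (α β : Bool) : grayRead F (grayState x α β) = F x α β := by
  simp [grayRead, grayState]

theorem flipAt_grayState_color (x : Fin (m + 1) → Bool) (α β : Bool) :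
    flipAt (grayState x α β) (.inr (.inl (color x))) = grayState x (!α) β := by
  funext j
  by_cases hj : j = .inr (.inl (color x))
  · subst hj; simp [grayState]
  · rw [flipAt_of_ne _ hj]
    rcases j with j | j | j
    · rfl
    · have : j ≠ color x := fun h => hj (by rw [h])
      simp [grayState, this]
    · rfl

theorem flipAt_grayState_parity (x : Fin (m + 1) → Bool) (α β : Bool) :
    flipAt (grayState x α β) (.inr (.inr (wordParity (Fin.tail x)))) = grayState x α (!β) := by
  funext j
  by_cases hj : j = .inr (.inr (wordParity (Fin.tail x)))
  · subst hj; simp [grayState]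
  · rw [flipAt_of_ne _ hj]
    rcases j with j | j | j
    · rfl
    · rfl
    · have : j ≠ wordParity (Fin.tail x) := fun h => hj (by rw [h])
      simp [grayState, this]

theorem flipAt_grayState_letter (x : Fin (m + 1) → Bool) (α β : Bool) (i : Fin (m + 1))
    (hα : α = true → color (flipAt x i) = color x)
    (hβ : β = true → wordParity (Fin.tail (flipAt x i)) = wordParity (Fin.tail x)) :
    flipAt (grayState x α β) (.inl i) = grayState (flipAt x i) α β := by
  funext j
  rcases j with j | j | j
  · by_cases hj : j = i
    · subst hj; simp [grayState]
    · rw [flipAt_of_ne _ (by simpa using hj)]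
      simp [grayState, flipAt_of_ne x hj]
  · rw [flipAt_of_ne _ (by simp)]
    cases α
    · simp [grayState]
    · simp [grayState, hα rfl]
  · rw [flipAt_of_ne _ (by simp)]
    cases β
    · simp [grayState]
    · simp [grayState, hβ rfl]

/-- The number of steps of the cycle before `grayState x α β`, up to a bounded factor. -/
def grayHeight (x : Fin (m + 1) → Bool) (α β : Bool) : ℕ :=
  3 * grayRank x + grayStage (wordParity x) α β

/-- Writing `(α, β)`, an even word passes through `(1,0), (1,1), (0,1)` and then switches letter `0`
with only the parity on; an odd word passes through `(0,1), (0,0), (1,0)` and then switches its mate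
with only the colour on. -/
theorem grayState_next (x : Fin (m + 1) → Bool) (α β : Bool) (h : grayOk x α β = true) :
    ∃ x' α' β', grayOk x' α' β' = true ∧
      flipAt (grayState x α β) (grayDir x α β) = grayState x' α' β' ∧
      grayDir x' α' β' ≠ grayDir x α β ∧
      ((grayState x' α' β' = grayState (fun _ => false) true false ∧
          2 ^ (m + 1) - 1 ≤ grayRank x) ∨
        (grayRank x' ≤ grayRank x + 1 ∧ grayHeight x α β < grayHeight x' α' β')) := by
  cases hp : wordParity x <;> cases α <;> cases β <;> simp only [grayOk, hp] at h
  · simp at h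
  · refine ⟨flipAt x 0, false, true, ?_, ?_, ?_, Or.inr ⟨?_, ?_⟩⟩
    · simp [grayOk]
    · have : grayDir x false true = .inl 0 := by simp [grayDir, hp]
      rw [this, flipAt_grayState_letter _ _ _ _ (by simp) (by simp [tail_flipAt_zero])]
    · simp [grayDir, hp, wordParity_flipAt]
    · rw [grayRank_flipAt_zero hp]
    · simp [grayHeight, grayRank_flipAt_zero hp, wordParity_flipAt, hp, grayStage]
      omega
  · refine ⟨x, true, true, ?_, ?_, ?_, Or.inr ⟨by omega, ?_⟩⟩
    · simp [grayOk, hp]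
    · have : grayDir x true false = .inr (.inr (wordParity (Fin.tail x))) := by simp [grayDir, hp]
      rw [this, flipAt_grayState_parity]; rfl
    · simp [grayDir, hp]
    · simp [grayHeight, hp, grayStage]
  · refine ⟨x, false, true, ?_, ?_, ?_, Or.inr ⟨by omega, ?_⟩⟩
    · simp [grayOk, hp]
    · have : grayDir x true true = .inr (.inl (color x)) := by simp [grayDir, hp]
      rw [this, flipAt_grayState_color]; rfl
    · simp [grayDir, hp]
    · simp [grayHeight, hp, grayStage]
  · refine ⟨x, true, false, ?_, ?_, ?_, Or.inr ⟨by omega, ?_⟩⟩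
    · simp [grayOk, hp]
    · have : grayDir x false false = .inr (.inl (color x)) := by simp [grayDir, hp]
      rw [this, flipAt_grayState_color]; rfl
    · simp [grayDir, hp]
    · simp [grayHeight, hp, grayStage]
  · refine ⟨x, false, false, ?_, ?_, ?_, Or.inr ⟨by omega, ?_⟩⟩
    · simp [grayOk, hp]
    · have : grayDir x false true = .inr (.inr (wordParity (Fin.tail x))) := by simp [grayDir, hp]
      rw [this, flipAt_grayState_parity]; rfl
    · simp [grayDir, hp]
    · simp [grayHeight, hp, grayStage]
  · refine ⟨flipAt x (grayMate x), true, false, ?_, ?_, ?_, ?_⟩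
    · simp [grayOk, wordParity_flipAt, hp]
    · have : grayDir x true false = .inl (grayMate x) := by simp [grayDir, hp]
      rw [this, flipAt_grayState_letter _ _ _ _ (fun _ => color_flipAt_grayMate x) (by simp)]
    · simp [grayDir, hp, wordParity_flipAt]
    · rcases grayRank_flipAt_grayMate hp with ⟨-, h2⟩ | ⟨h1, h2⟩
      · right
        simp [grayHeight, h2, wordParity_flipAt, hp, grayStage]
        omega
      · left
        rw [h1]
        exact ⟨rfl, by omega⟩
  · simp at h

/-- Along a letter edge, a colour that is on forces the letter to be the mate, and a parity that is
on forces letter `0`. Both cannot be off, since one of the two words is even and `grayOk` excludes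
this there. -/
theorem grayState_induced (x x' : Fin (m + 1) → Bool) (α β α' β' : Bool)
    (h : grayOk x α β = true) (h' : grayOk x' α' β' = true) (i : GrayIndex m)
    (hi : flipAt (grayState x α β) i = grayState x' α' β') :
    i = grayDir x α β ∨ i = grayDir x' α' β' := by
  rcases i with i | k | k
  · obtain rfl : x' = flipAt x i := by
      funext j
      have := congrFun hi (.inl j)
      by_cases hj : j = i
      · subst hj; simpa [grayState] using this.symm
      · rw [flipAt_of_ne _ (by simpa using hj)] at this
        simpa [grayState, flipAt_of_ne _ hj] using this.symm
    have hc : ∀ k, (α && decide (k = color x)) = (α' && decide (k = color (flipAt x i))) := by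
      intro k
      have := congrFun hi (.inr (.inl k))
      rwa [flipAt_of_ne _ (by simp)] at this
    have hq : ∀ k, (β && decide (k = wordParity (Fin.tail x))) =
        (β' && decide (k = wordParity (Fin.tail (flipAt x i)))) := by
      intro k
      have := congrFun hi (.inr (.inr k))
      rwa [flipAt_of_ne _ (by simp)] at this
    have hα : α = true → color (flipAt x i) = color x ∧ α' = true := by
      rintro rfl
      have := hc (color x)
      simp at this
      exact ⟨this.2.symm, this.1⟩
    have hβ : β = true → i = 0 ∧ β' = true := by
      rintro rfl
      have := hq (wordParity (Fin.tail x))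
      simp at this
      refine ⟨?_, this.1⟩
      cases i using Fin.cases with
      | zero => rfl
      | succ i => rw [tail_flipAt_succ, wordParity_flipAt] at this; simp at this
    have hα' : α = false → α' = false := by
      rintro rfl
      simpa using (hc (color (flipAt x i))).symm
    have hβ' : β = false → β' = false := by
      rintro rfl
      simpa using (hq (wordParity (Fin.tail (flipAt x i)))).symm
    cases α
    · obtain rfl := hα' rfl
      cases β
      · obtain rfl := hβ' rfl
        cases hp : wordParity x <;> simp [grayOk, wordParity_flipAt, hp] at h h'
      · obtain ⟨rfl, rfl⟩ := hβ rfl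
        cases hp : wordParity x <;> simp [grayDir, wordParity_flipAt, hp]
    · obtain ⟨hx, rfl⟩ := hα rfl
      obtain rfl := eq_grayMate_of_color_eq x i hx
      cases hp : wordParity x <;> simp [grayDir, wordParity_flipAt, hp, grayMate_flipAt_grayMate]
  · obtain rfl : x' = x := by
      funext j
      have := congrFun hi (.inl j)
      rw [flipAt_of_ne _ (by simp)] at this
      exact this.symm
    have hk : k = color x' := by
      by_contra hk
      have := congrFun hi (.inr (.inl k))
      simp [grayState, hk] at this
    subst hk
    rw [flipAt_grayState_color] at hi
    have h1 := congrArg (grayRead fun _ a _ => a) hi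
    have h2 := congrArg (grayRead fun _ _ b => b) hi
    simp only [grayRead_grayState] at h1 h2
    subst h1 h2
    cases hp : wordParity x' <;> cases α <;> cases β <;> simp_all [grayDir, grayOk]
  · obtain rfl : x' = x := by
      funext j
      have := congrFun hi (.inl j)
      rw [flipAt_of_ne _ (by simp)] at this
      exact this.symm
    have hk : k = wordParity (Fin.tail x') := by
      by_contra hk
      have := congrFun hi (.inr (.inr k))
      simp [grayState, hk] at this
    subst hk
    rw [flipAt_grayState_parity] at hi
    have h1 := congrArg (grayRead fun _ a _ => a) hi
    have h2 := congrArg (grayRead fun _ _ b => b) hi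
    simp only [grayRead_grayState] at h1 h2
    subst h1 h2
    cases hp : wordParity x' <;> cases α <;> cases β <;> simp_all [grayDir, grayOk]

theorem grayHeight_lt (x : Fin (m + 1) → Bool) (α β : Bool) :
    grayHeight x α β < 3 * 2 ^ (m + 1) := by
  have h1 := grayRank_lt x
  have h2 := grayStage_le (wordParity x) α β
  rw [grayHeight]
  omega

theorem grayHeight_base : grayHeight (fun _ : Fin (m + 1) => false) true false = 0 := by
  rw [grayHeight, wordParity_zero, grayRank_zero]
  rfl

/-- The induced cycle that runs through all words of length `m + 1` in the order of the Gray
code. -/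
def grayCycle (m : ℕ) : InducedCycle (GrayIndex m) where
  mem v := ∃ x α β, grayOk x α β = true ∧ v = grayState x α β
  dir := grayRead grayDir
  base := grayState (fun _ => false) true false
  rank := grayRead fun x _ _ => grayRank x
  height := grayRead grayHeight
  span := 2 ^ (m + 1) - 1
  bound := 3 * 2 ^ (m + 1)
  mem_next := by
    rintro _ ⟨x, α, β, h, rfl⟩
    obtain ⟨x', α', β', h1, h2, -⟩ := grayState_next x α β h
    exact ⟨x', α', β', h1, by rw [grayRead_grayState, h2]⟩
  induced := by
    rintro _ i ⟨x, α, β, h, rfl⟩ ⟨x', α', β', h', hi⟩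
    rw [hi, grayRead_grayState, grayRead_grayState]
    exact grayState_induced x x' α β α' β' h h' i hi
  dir_next_ne := by
    rintro _ ⟨x, α, β, h, rfl⟩
    obtain ⟨x', α', β', -, h2, h3, -⟩ := grayState_next x α β h
    rwa [grayRead_grayState, h2, grayRead_grayState]
  mem_base := ⟨_, _, _, by simp [grayOk, wordParity_zero], rfl⟩
  rank_base := by rw [grayRead_grayState, grayRank_zero]
  span_le := by
    rintro _ ⟨x, α, β, h, rfl⟩ hb
    obtain ⟨x', α', β', -, h2, -, h4 | h4⟩ := grayState_next x α β h
    · rw [grayRead_grayState]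
      exact h4.2
    · rw [grayRead_grayState, h2] at hb
      have h5 := congrArg (grayRead grayHeight) hb
      rw [grayRead_grayState, grayRead_grayState, grayHeight_base] at h5
      omega
  rank_next := by
    rintro _ ⟨x, α, β, h, rfl⟩ hb
    obtain ⟨x', α', β', -, h2, -, h4 | h4⟩ := grayState_next x α β h
    · rw [grayRead_grayState, h2] at hb
      exact absurd h4.1 hb
    · rw [grayRead_grayState, h2, grayRead_grayState, grayRead_grayState]
      exact h4.1
  height_next := by
    rintro _ ⟨x, α, β, h, rfl⟩
    obtain ⟨x', α', β', -, h2, -, h4 | h4⟩ := grayState_next x α β h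
    · rw [grayRead_grayState, h2]
      exact Or.inl h4.1
    · rw [grayRead_grayState, h2, grayRead_grayState, grayRead_grayState]
      exact Or.inr h4.2
  height_lt := by
    rintro _ ⟨x, α, β, -, rfl⟩
    rw [grayRead_grayState]
    exact grayHeight_lt x α β

theorem card_grayNodes (m : ℕ) : Fintype.card (Option (Option (GrayIndex m))) = m + 13 := by
  simp [GrayIndex]

end GrayCycle

/-! ### The theorem -/

theorem mainTheorem4 :
    ∃ c : ℝ, 0 < c ∧ ∃ N : ℕ, ∀ n : ℕ, N ≤ n →
      ∃ r : ℕ, c * (2 : ℝ) ^ n ≤ (r : ℝ) ∧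
        ∃ G : InteractionSystem n,
          (∀ i : Fin n, Nat.card (G.Act i) = 2) ∧
          (∀ i : Fin n, G.IsHistoryless i) ∧
          (∀ i : Fin n, G.IsSelfIndependent i) ∧
          G.IsRConvergent r ∧ ¬ G.IsRConvergent (r + 1) := by
  refine ⟨(1 / 2) ^ 14, by positivity, 14, fun n hn => ?_⟩
  obtain ⟨m, rfl⟩ := Nat.exists_eq_add_of_le' hn
  -- Words of length `m + 2`, eight colours, two parities and two latch nodes make `m + 14` nodes.
  -- This word length gives `2 * 2 ^ m + 1 ≤ span`, hence convergence at fairness `2 ^ m`, which is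
  -- `c * 2 ^ n`.
  let K := grayCycle (m + 1)
  let e : Fin (m + 14) ≃ Option (Option (GrayIndex (m + 1))) :=
    (Fintype.equivFinOfCardEq (by rw [card_grayNodes])).symm
  have hspan : K.span = 2 ^ (m + 2) - 1 := rfl
  have hpow : 1 ≤ 2 ^ m := Nat.one_le_two_pow
  have hconv : (InteractionSystem.ofRule e K.reaction).IsRConvergent (2 ^ m) :=
    InteractionSystem.ofRule_isRConvergent e _ fun τ a ha hτ =>
      K.eventually_const ha (by rw [hspan, pow_add]; omega) hτ
  have hdiv : ¬ (InteractionSystem.ofRule e K.reaction).IsRConvergent (K.bound + 1) :=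
    InteractionSystem.not_ofRule_isRConvergent e _ K.isRun_walkState K.walkSchedule_fair
      K.walkState_succ_ne
  obtain ⟨r, hr, h1, h2⟩ :=
    InteractionSystem.exists_isRConvergent_and_not_succ _ hconv hdiv
  refine ⟨r, ?_, InteractionSystem.ofRule e K.reaction, fun i => ?_,
    InteractionSystem.ofRule_isHistoryless e _,
    InteractionSystem.ofRule_isSelfIndependent e _ K.reaction_update, h1, h2⟩
  · have h3 : ((2 ^ m : ℕ) : ℝ) ≤ r := by exact_mod_cast hr
    have h4 : (1 / 2 : ℝ) ^ 14 * 2 ^ (m + 14) = 2 ^ m := by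
      rw [pow_add]; ring
    rw [h4]
    simpa using h3
  · simp
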